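/- Let $T_1,\dots,T_d$ be commuting, invertible, bimeasurable, measure preserving maps of a probability space $(E,\mathcal A,\mu)$, write $T^{\ell}f(x)=f(T_1^{\ell_1}\cdots T_d^{\ell_d}x)$ for $\ell\in\mathbb Z^d$, and let $f\in L^\infty(\mu)$ be real valued with $\int f\,d\mu=0$ and $\sum_{k\in\mathbb Z^d}\bigl|\int T^kf\cdot f\,d\mu\bigr|<\infty$. Then there is a (unique) continuous function $\varphi_f$ on $\mathbb T^d=(\mathbb R/\mathbb Z)^d$, the spectral density of $f$, with $\int T^kf\cdot f\,d\mu=\int_{\mathbb T^d}e^{2\pi i\langle k,t\rangle}\varphi_f(t)\,dt$ for all $k\in\mathbb Z^d$. For $j=1,\dots,s$ let $\xi_j$ be a probability measure on $\mathbb T^d$ and let $(w_{n,j})_{n}$ be a summation sequence, i.e. functions $w_{n,j}:\mathbb Z^d\to\mathbb R$ with $0<\sum_{\ell}|w_{n,j}(\ell)|<\infty$. Put $\|w_{n,j}\|_2^2=\sum_{\ell}w_{n,j}(\ell)^2$ and $W_{n,j}(t)=\sum_{\ell}w_{n,j}(\ell)e^{2\pi i\langle\ell,t\rangle}$. Assume: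 1. ($\xi_j$-regularity) for every $j$ and every continuous $\varphi$ on $\mathbb T^d$, $\displaystyle\lim_{n\to\infty}\|w_{n,j}\|_2^{-2}\int_{\mathbb T^d}|W_{n,j}(t)|^2\varphi(t)\,dt=\int\varphi\,d\xi_j=:\xi_j(\varphi)$; 2. (the weights are of the same order) $\|w_{n,j}\|_2^2=O(\|w_{n,j'}\|_2^2)$ as $n\to\infty$, for all $j,j'$; 3. (asymptotic orthogonality) for all $j\ne j'$ and all $p\in\mathbb Z^d$, $\displaystyle\int_{\mathbb T^d}W_{n,j}(t)\,\overline{W_{n,j'}(t)}\,e^{-2\pi i\langle p,t\rangle}\,dt=o\bigl(\|w_{n,j}\|_2^2+\|w_{n,j'}\|_2^2\bigr)$; 4. (negligible normalized cumulants of order $\ge3$) for all $r\ge3$ and all $(i_1,\dots,i_r)\in\{1,\dots,s\}^r$, $$\sum_{(\ell_1,\dots,\ell_r)\in(\mathbb Z^d)^r}w_{n,i_1}(\ell_1)\cdots w_{n,i_r}(\ell_r)\,C(T^{\ell_1}f,\dots,T^{\ell_r}f)=o\Bigl(\bigl(\|w_{n,1}\|_2^2+\dots+\|w_{n,s}\|_2^2\bigr)^{r/2}\Bigr),$$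 where $C(X_1,\dots,X_r)=\sum_{\Pi}(-1)^{|\Pi|-1}(|\Pi|-1)!\prod_{I\in\Pi}\mathbb E\bigl(\prod_{i\in I}X_i\bigr)$ is the joint cumulant, $\Pi$ running over the partitions of $\{1,\dots,r\}$ into nonempty sets. Then $\xi_j(\varphi_f)\ge0$ for every $j$, and, as $n\to\infty$, the random vectors $$\Bigl(\frac{\sum_{\ell}w_{n,1}(\ell)T^{\ell}f}{\|w_{n,1}\|_2},\dots,\frac{\sum_{\ell}w_{n,s}(\ell)T^{\ell}f}{\|w_{n,s}\|_2}\Bigr)$$ on $(E,\mu)$ converge in distribution to $\mathcal N(0,J_s)$, where $J_s$ is the diagonal matrix with diagonal entries $\xi_1(\varphi_f),\dots,\xi_s(\varphi_f)$. -/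

import Mathlib

open MeasureTheory ProbabilityTheory Filter Topology Asymptotics

noncomputable section

namespace WeightedCLT

/-- `ℤ^d`. -/
abbrev Lattice (d : ℕ) : Type := Fin d → ℤ

/-- `𝕋^d = (ℝ/ℤ)^d`. -/
abbrev Torus (d : ℕ) : Type := UnitAddTorus (Fin d)

/-- The normalized Lebesgue (Haar) measure `dt` on `𝕋^d`. -/
def torusMeasure (d : ℕ) : Measure (Torus d) :=
  Measure.pi fun _ : Fin d => AddCircle.haarAddCircle

section Action

variable {E : Type*} [MeasurableSpace E]

/-- `T^ℓ x = T₁^{ℓ₁} ⋯ T_d^{ℓ_d} x` (used for commuting invertible maps, so that the order of the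
factors is irrelevant). -/
def act {d : ℕ} (T : Fin d → E ≃ᵐ E) (l : Lattice d) : Equiv.Perm E :=
  (List.ofFn fun i => ((T i).toEquiv : Equiv.Perm E) ^ l i).prod

/-- `T₁, …, T_d` are commuting maps preserving `μ`. -/
structure IsCommutingAction {d : ℕ} (μ : Measure E) (T : Fin d → E ≃ᵐ E) : Prop where
  measurePreserving : ∀ i, MeasurePreserving (T i) μ μ
  commute : ∀ i j x, T i (T j x) = T j (T i x)

/-- The random field `X_ℓ = T^ℓ f`. -/
def field {d : ℕ} (T : Fin d → E ≃ᵐ E) (f : E → ℝ) (l : Lattice d) : E → ℝ :=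
  fun x => f (act T l x)

/-- The correlation `∫ T^k f · f dμ` (here `f` is real valued). -/
def correlation {d : ℕ} (μ : Measure E) (T : Fin d → E ≃ᵐ E) (f : E → ℝ) (k : Lattice d) : ℝ :=
  ∫ x, field T f k x * f x ∂μ

/-- The continuous function `φ` on `𝕋^d` is the spectral density of `f`:
`∫ T^k f · f dμ = ∫ e^{2πi⟨k,t⟩} φ(t) dt` for all `k`. Continuous functions on `𝕋^d` being
determined by their Fourier coefficients, there is at most one such `φ`. -/
def IsSpectralDensity {d : ℕ} (μ : Measure E) (T : Fin d → E ≃ᵐ E) (f : E → ℝ)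
    (φ : C(Torus d, ℝ)) : Prop :=
  ∀ k : Lattice d, ((correlation μ T f k : ℝ) : ℂ) =
    ∫ t, UnitAddTorus.mFourier k t * (φ t : ℂ) ∂(torusMeasure d)

/-- The joint cumulant of `(X_1, …, X_r)`, as the alternating sum over the partitions `P` of the
index set of `(-1)^{|P|-1} (|P|-1)! ∏_{I ∈ P} 𝔼 ∏_{i ∈ I} X_i` (used for `r ≥ 3`, so that
`|P| ≥ 1`). -/
def cumulant (μ : Measure E) {r : ℕ} (X : Fin r → E → ℝ) : ℝ :=
  ∑ P : Finpartition (Finset.univ : Finset (Fin r)),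
    (-1 : ℝ) ^ (P.parts.card - 1) * ((P.parts.card - 1).factorial : ℝ) *
      ∏ I ∈ P.parts, ∫ x, ∏ i ∈ I, X i x ∂μ

end Action

/-- A summation sequence: for each `n` a real function `w n` on `ℤ^d` with
`0 < ∑_ℓ |w_n(ℓ)| < ∞`. -/
def IsSummationSequence {d : ℕ} (w : ℕ → Lattice d → ℝ) : Prop :=
  ∀ n, Summable (fun l => |w n l|) ∧ 0 < ∑' l, |w n l|

/-- `∑_ℓ v(ℓ)²`. -/
def sqSum {d : ℕ} (v : Lattice d → ℝ) : ℝ := ∑' l, v l ^ 2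

/-- `t ↦ ∑_ℓ v(ℓ) e^{2πi⟨ℓ,t⟩}`. -/
def trigSum {d : ℕ} (v : Lattice d → ℝ) (t : Torus d) : ℂ :=
  ∑' l, (v l : ℂ) * UnitAddTorus.mFourier l t

/-- The normalized kernel `K(v)(t) = |∑_ℓ v(ℓ) e^{2πi⟨ℓ,t⟩}|² / ∑_ℓ v(ℓ)²`. -/
def kernel {d : ℕ} (v : Lattice d → ℝ) (t : Torus d) : ℝ :=
  ‖trigSum v t‖ ^ 2 / sqSum v

/-- `w` is `ξ`-regular: the measures `K(w_n) dt` converge weakly to `ξ`. -/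
def IsRegular {d : ℕ} (ξ : Measure (Torus d)) (w : ℕ → Lattice d → ℝ) : Prop :=
  ∀ φ : C(Torus d, ℝ),
    Tendsto (fun n => ∫ t, kernel (w n) t * φ t ∂(torusMeasure d)) atTop (𝓝 (∫ t, φ t ∂ξ))

/-- Asymptotic orthogonality of the summation sequences `w 1, …, w s`. -/
def AsymptoticallyOrthogonal {d s : ℕ} (w : Fin s → ℕ → Lattice d → ℝ) : Prop :=
  ∀ j j' : Fin s, j ≠ j' → ∀ p : Lattice d,
    (fun n => ∫ t, trigSum (w j n) t * (starRingEnd ℂ) (trigSum (w j' n) t) *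
        UnitAddTorus.mFourier (-p) t ∂(torusMeasure d))
      =o[atTop] fun n => sqSum (w j n) + sqSum (w j' n)

/-- Convergence to `0` of the normalized cumulants of order `≥ 3` of the field `X`. -/
def NegligibleCumulants {E : Type*} [MeasurableSpace E] {d s : ℕ} (μ : Measure E)
    (X : Lattice d → E → ℝ) (w : Fin s → ℕ → Lattice d → ℝ) : Prop :=
  ∀ r : ℕ, 3 ≤ r → ∀ i : Fin r → Fin s,
    (fun n => ∑' l : Fin r → Lattice d,
        (∏ k, w (i k) n (l k)) * cumulant μ (fun k => X (l k)))
      =o[atTop] fun n => (∑' l : Lattice d, ∑ j, w j n l ^ 2) ^ ((r : ℝ) / 2)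

/-- The vector with coordinates `∑_ℓ w_{n,j}(ℓ) X_ℓ / (∑_ℓ w_{n,j}(ℓ)²)^{1/2}`, `j = 1, …, s`. -/
def normalizedSums {E : Type*} {d s : ℕ} (X : Lattice d → E → ℝ)
    (w : Fin s → ℕ → Lattice d → ℝ) (n : ℕ) (x : E) : EuclideanSpace ℝ (Fin s) :=
  WithLp.toLp 2 fun j => (∑' l, w j n l * X l x) / Real.sqrt (sqSum (w j n))

end WeightedCLT

end

/-!
Every covariance of the normalized sums is the integral of `φ` against `W_{n,j} conj W_{n,j'} dt`,
suitably normalized, where the spectral density `φ` is the absolutely convergent Fourier series of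
the correlations: regularity gives the limit on the diagonal, asymptotic orthogonality kills the
off-diagonal terms. Cumulants are multilinear, so for a linear combination of the coordinates all
those of order `≥ 3` vanish in the limit. The moments are a polynomial function of the cumulants
(single out the block of a given point in a partition), hence they converge to Gaussian moments;
an exponential Taylor expansion turns this into convergence of characteristic functions, and
Lévy's theorem concludes.
-/

namespace WeightedCLT

section Partitions

variable {α β R : Type*} [DecidableEq α] [DecidableEq β] [CommRing R]

/-- The coefficient `(-1)^{q-1} (q-1)!` of a partition into `q` parts in the formula for cumulants
(the Möbius function of the partition lattice), with the value `1` at `q = 0`. -/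
def cumulantCoeff (R : Type*) [CommRing R] (q : ℕ) : R := (-1) ^ (q - 1) * ((q - 1).factorial : R)

/-- The joint cumulant of a family indexed by `S`, as a function of its mixed moments `m I`,
`I ⊆ S`. -/
def partitionCumulant (m : Finset α → R) (S : Finset α) : R :=
  ∑ P : Finpartition S, cumulantCoeff R P.parts.card * ∏ I ∈ P.parts, m I

theorem parts_avoid_of_mem {S B : Finset α} {Q : Finpartition S} (hB : B ∈ Q.parts) :
    (Q.avoid B).parts = Q.parts.erase B := by
  have hdisj {C : Finset α} (hC : C ∈ Q.parts) (hne : C ≠ B) : Disjoint C B := Q.disjoint hC hB hne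
  ext C
  rw [Finpartition.mem_avoid, Finset.mem_erase]
  constructor
  · rintro ⟨D, hD, hDB, rfl⟩
    have hne : D ≠ B := fun h => hDB h.le
    rw [Finset.sdiff_eq_self_of_disjoint (hdisj hD hne)]
    exact ⟨hne, hD⟩
  · rintro ⟨hne, hC⟩
    exact ⟨C, hC, fun h => Q.ne_bot hC ((hdisj hC hne).eq_bot_of_le h),
      Finset.sdiff_eq_self_of_disjoint (hdisj hC hne)⟩

theorem notMem_parts_sdiff {S B : Finset α} (hB : B.Nonempty) (P : Finpartition (S \ B)) :
    B ∉ P.parts := fun h =>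
  hB.ne_empty ((Finset.disjoint_self_iff_empty B).1
    (Finset.disjoint_of_subset_left (P.subset h) Finset.sdiff_disjoint))

theorem sum_finpartition_mem_parts {M : Type*} [AddCommMonoid M] {S B : Finset α} (hBS : B ⊆ S)
    (hB : B.Nonempty) (F : Finset (Finset α) → M) :
    ∑ Q : Finpartition S with B ∈ Q.parts, F Q.parts =
      ∑ P : Finpartition (S \ B), F (insert B P.parts) := by
  let e (P : Finpartition (S \ B)) : Finpartition S :=
    P.extend hB.ne_empty Finset.sdiff_disjoint (Finset.sdiff_union_of_subset hBS)
  have he (P) : B ∈ (e P).parts := by simp [e]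
  have hinsert {Q : Finpartition S} (hQ : B ∈ Q.parts) : insert B (Q.avoid B).parts = Q.parts := by
    rw [parts_avoid_of_mem hQ, Finset.insert_erase hQ]
  refine Finset.sum_bij' (fun Q _ => Q.avoid B) (fun P _ => e P) (fun _ _ => Finset.mem_univ _)
    (fun P _ => by simp [he]) (fun Q hQ => ?_) (fun P _ => ?_) (fun Q hQ => ?_)
  · exact Finpartition.ext (hinsert (Finset.mem_filter.1 hQ).2)
  · refine Finpartition.ext ?_
    rw [parts_avoid_of_mem (he P), Finpartition.extend_parts,
      Finset.erase_insert (notMem_parts_sdiff hB P)]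
  · rw [hinsert (Finset.mem_filter.1 hQ).2]

theorem partitionCumulant_sdiff_mul (m : Finset α → R) {S B : Finset α} (hBS : B ⊆ S)
    (hB : B.Nonempty) :
    partitionCumulant m (S \ B) * m B =
      ∑ Q : Finpartition S with B ∈ Q.parts,
        cumulantCoeff R (Q.parts.card - 1) * ∏ I ∈ Q.parts, m I := by
  rw [sum_finpartition_mem_parts hBS hB
    (fun C => cumulantCoeff R (C.card - 1) * ∏ I ∈ C, m I), partitionCumulant, Finset.sum_mul]
  refine Finset.sum_congr rfl fun P _ => ?_
  rw [Finset.card_insert_of_notMem (notMem_parts_sdiff hB P),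
    Finset.prod_insert (notMem_parts_sdiff hB P), Nat.add_sub_cancel]
  ring

theorem filter_mem_parts_eq_erase_part {S : Finset α} {a : α} (ha : a ∈ S) (Q : Finpartition S) :
    {B ∈ (S.erase a).powerset.erase ∅ | B ∈ Q.parts} = Q.parts.erase (Q.part a) := by
  ext B
  simp only [Finset.mem_filter, Finset.mem_erase, Finset.mem_powerset, Finset.subset_erase]
  constructor
  · rintro ⟨⟨_, _, haB⟩, hB⟩
    exact ⟨fun h => haB (h ▸ Q.mem_part_self.2 ha), hB⟩
  · rintro ⟨hne, hB⟩
    exact ⟨⟨Q.ne_empty hB, Q.subset hB, fun haB => hne (Q.part_eq_of_mem hB haB).symm⟩, hB⟩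

theorem cumulantCoeff_add_mul {q : ℕ} (hq : q ≠ 0) :
    cumulantCoeff R q + ((q - 1 : ℕ) : R) * cumulantCoeff R (q - 1) = if q = 1 then 1 else 0 := by
  obtain _ | _ | q := q
  · contradiction
  · simp [cumulantCoeff]
  · simp only [cumulantCoeff, Nat.add_sub_cancel, Nat.factorial_succ]
    rw [if_neg (by lia), pow_succ]
    push_cast
    ring

theorem sum_finpartition_card_eq_one {M : Type*} [AddCommMonoid M] {S : Finset α}
    (hS : S.Nonempty) (F : Finset (Finset α) → M) :
    ∑ Q : Finpartition S, (if Q.parts.card = 1 then F Q.parts else 0) = F {S} := by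
  rw [Finset.sum_eq_single (Finpartition.indiscrete hS.ne_empty) (fun Q _ hQ => if_neg fun h => ?_)
    (fun h => absurd (Finset.mem_univ _) h)]
  · simp
  · obtain ⟨B, hB⟩ := Finset.card_eq_one.1 h
    have hBS : B = S := by simpa [hB] using Q.sup_parts
    exact hQ (Finpartition.ext (by rw [hB, hBS, Finpartition.indiscrete_parts]))

/-- A partition with `q` parts has `q - 1` parts avoiding `a`, so after interchanging the sums over
`B` and over partitions, `cumulantCoeff_add_mul` leaves only the partition with one part. -/
theorem partitionCumulant_add_sum (m : Finset α → R) {S : Finset α} {a : α} (ha : a ∈ S) :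
    partitionCumulant m S +
      ∑ B ∈ (S.erase a).powerset.erase ∅, partitionCumulant m (S \ B) * m B = m S := by
  have hS : S.Nonempty := ⟨a, ha⟩
  have hsum : ∑ B ∈ (S.erase a).powerset.erase ∅, partitionCumulant m (S \ B) * m B =
      ∑ Q : Finpartition S, ((Q.parts.card - 1 : ℕ) : R) *
        (cumulantCoeff R (Q.parts.card - 1) * ∏ I ∈ Q.parts, m I) := by
    have hB {B : Finset α} (h : B ∈ (S.erase a).powerset.erase ∅) := Finset.mem_erase.1 h
    rw [Finset.sum_congr rfl fun B h => partitionCumulant_sdiff_mul m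
      ((Finset.mem_powerset.1 (hB h).2).trans (Finset.erase_subset _ _))
      (Finset.nonempty_iff_ne_empty.2 (hB h).1)]
    simp_rw [Finset.sum_filter]
    rw [Finset.sum_comm]
    refine Finset.sum_congr rfl fun Q _ => ?_
    rw [← Finset.sum_filter, Finset.sum_const, nsmul_eq_mul, filter_mem_parts_eq_erase_part ha,
      Finset.card_erase_of_mem (Q.part_mem.2 ha)]
  rw [hsum, partitionCumulant, ← Finset.sum_add_distrib]
  calc ∑ Q : Finpartition S, (cumulantCoeff R Q.parts.card * ∏ I ∈ Q.parts, m I +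
        ((Q.parts.card - 1 : ℕ) : R) *
          (cumulantCoeff R (Q.parts.card - 1) * ∏ I ∈ Q.parts, m I))
      = ∑ Q : Finpartition S, if Q.parts.card = 1 then ∏ I ∈ Q.parts, m I else 0 := by
        refine Finset.sum_congr rfl fun Q _ => ?_
        rw [← mul_assoc, ← add_mul, cumulantCoeff_add_mul
          (Finset.card_pos.2 (Q.parts_nonempty hS.ne_empty)).ne', ite_mul, one_mul, zero_mul]
    _ = m S := by
        rw [sum_finpartition_card_eq_one hS fun C => ∏ I ∈ C, m I, Finset.prod_singleton]

theorem partitionCumulant_empty (m : Finset α → R) : partitionCumulant m ∅ = 1 := by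
  have : Unique (Finpartition (∅ : Finset α)) :=
    inferInstanceAs (Unique (Finpartition (⊥ : Finset α)))
  rw [partitionCumulant, Fintype.sum_unique, Finpartition.parts_eq_empty_iff.2 rfl]
  simp [cumulantCoeff]

theorem partitionCumulant_map (e : α ↪ β) (m : Finset β → R) (S : Finset α) :
    partitionCumulant m (S.map e) = partitionCumulant (fun I => m (I.map e)) S := by
  induction S using Finset.strongInduction with
  | H S ih =>
  obtain rfl | ⟨a, ha⟩ := S.eq_empty_or_nonempty
  · simp only [Finset.map_empty, partitionCumulant_empty]
  · have hmap := partitionCumulant_add_sum m (Finset.mem_map_of_mem e ha)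
    have hS := partitionCumulant_add_sum (fun I => m (I.map e)) ha
    have hsum : ∑ C ∈ ((S.map e).erase (e a)).powerset.erase ∅,
        partitionCumulant m (S.map e \ C) * m C =
        ∑ B ∈ (S.erase a).powerset.erase ∅,
          partitionCumulant (fun I => m (I.map e)) (S \ B) * m (B.map e) := by
      rw [← Finset.map_erase]
      refine (Finset.sum_nbij (Finset.map e) (fun B hB => ?_)
        (Finset.map_injective e).injOn (fun C hC => ?_) fun B hB => ?_).symm
      · simpa only [Finset.mem_erase, Finset.mem_powerset, Finset.map_subset_map, ne_eq,
          Finset.map_eq_empty] using hB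
      · obtain ⟨hne, hC⟩ := Finset.mem_erase.1 (Finset.mem_coe.1 hC)
        obtain ⟨B, hB, rfl⟩ := Finset.subset_map_iff.1 (Finset.mem_powerset.1 hC)
        refine ⟨B, Finset.mem_coe.2 (Finset.mem_erase.2 ⟨?_, Finset.mem_powerset.2 hB⟩), rfl⟩
        simpa using hne
      · obtain ⟨hne, hBS⟩ : B ≠ ∅ ∧ B ⊆ S.erase a := by simpa using hB
        rw [← Finset.map_sdiff, ih _ (Finset.sdiff_ssubset (hBS.trans (S.erase_subset a))
          (Finset.nonempty_iff_ne_empty.2 hne))]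
    exact add_right_cancel (hmap.trans (hS.symm.trans (congrArg _ hsum.symm)))

theorem partitionCumulant_card (m : ℕ → R) (S : Finset α) :
    partitionCumulant (fun I => m I.card) S =
      partitionCumulant (fun I => m I.card) (Finset.univ : Finset (Fin S.card)) := by
  have hS : Finset.univ.map (S.equivFin.symm.toEmbedding.trans (.subtype _)) = S := by
    simp [← Finset.map_map, Finset.attach_map_val]
  conv_lhs => rw [← hS]
  simp only [partitionCumulant_map, Finset.card_map]

/-- The cumulant of order `r` of a random variable, as a function of its moments `m`. -/
def cumulantOfMoments (m : ℕ → R) (r : ℕ) : R :=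
  partitionCumulant (fun I => m I.card) (Finset.univ : Finset (Fin r))

theorem sum_choose_mul_cumulantOfMoments_mul (m : ℕ → R) (h0 : m 0 = 1) (n : ℕ) :
    ∑ j ∈ Finset.range (n + 1), (n.choose j : R) * (cumulantOfMoments m (n + 1 - j) * m j) =
      m (n + 1) := by
  have hrec := partitionCumulant_add_sum (fun I => m I.card) (Finset.mem_univ (0 : Fin (n + 1)))
  have hpow := Finset.sum_powerset_apply_card (x := (Finset.univ : Finset (Fin (n + 1))).erase 0)
    fun j => cumulantOfMoments m (n + 1 - j) * m j
  have hcard : ((Finset.univ : Finset (Fin (n + 1))).erase 0).card = n := by simp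
  simp only [hcard, nsmul_eq_mul] at hpow
  rw [Finset.card_univ, Fintype.card_fin] at hrec
  rw [← hpow, ← hrec, ← Finset.add_sum_erase _ _ (Finset.empty_mem_powerset _)]
  congr 1
  · rw [Finset.card_empty, h0, mul_one, cumulantOfMoments, Nat.sub_zero]
  · refine Finset.sum_congr rfl fun B _ => ?_
    rw [partitionCumulant_card, Finset.card_sdiff_of_subset B.subset_univ, Finset.card_univ,
      Fintype.card_fin, cumulantOfMoments]

end Partitions

section GaussianMoments

open scoped NNReal

variable {v : ℝ≥0}

theorem iteratedDeriv_mgf_id_gaussianReal (v : ℝ≥0) (n : ℕ) (t : ℝ) :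
    iteratedDeriv (n + 2) (mgf id (gaussianReal 0 v)) t =
      v * (t * iteratedDeriv (n + 1) (mgf id (gaussianReal 0 v)) t +
        (n + 1) * iteratedDeriv n (mgf id (gaussianReal 0 v)) t) := by
  set g := mgf id (gaussianReal 0 v)
  have hg : g = fun t => Real.exp (v * t ^ 2 / 2) := by
    simp only [g, mgf_id_gaussianReal, zero_mul, zero_add]
  have hdiff (n : ℕ) (t : ℝ) : HasDerivAt (iteratedDeriv n g) (iteratedDeriv (n + 1) g t) t := by
    have hsmooth : ContDiff ℝ ⊤ g := by rw [hg]; fun_prop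
    rw [iteratedDeriv_succ]
    exact (hsmooth.differentiable_iteratedDeriv n
      (by exact_mod_cast WithTop.coe_lt_top _) t).hasDerivAt
  induction n generalizing t with
  | zero =>
    have hderiv : iteratedDeriv (0 + 1) g = fun t => v * (t * iteratedDeriv 0 g t) := by
      ext t
      rw [zero_add, iteratedDeriv_one, iteratedDeriv_zero, hg]
      refine HasDerivAt.deriv ?_
      convert! (((hasDerivAt_pow 2 t).const_mul (v : ℝ)).div_const 2).exp using 1
      push_cast
      ring
    have h := ((hasDerivAt_id t).mul (hdiff 0 t)).const_mul (v : ℝ)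
    rw [iteratedDeriv_succ]
    refine (congrArg (deriv · t) hderiv).trans (h.deriv.trans ?_)
    simp only [id, Nat.cast_zero]
    ring
  | succ n ih =>
    have h := (((hasDerivAt_id t).mul (hdiff (n + 1) t)).add
      ((hdiff n t).const_mul ((n : ℝ) + 1))).const_mul (v : ℝ)
    rw [iteratedDeriv_succ]
    refine (congrArg (deriv · t) (funext ih)).trans (h.deriv.trans ?_)
    push_cast
    simp only [id]
    ring

theorem integral_pow_add_two_gaussianReal (v : ℝ≥0) (n : ℕ) :
    ∫ y, y ^ (n + 2) ∂gaussianReal 0 v = (n + 1) * v * ∫ y, y ^ n ∂gaussianReal 0 v := by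
  have hmoment (n : ℕ) : iteratedDeriv n (mgf id (gaussianReal 0 v)) 0 =
      ∫ y, y ^ n ∂gaussianReal 0 v := by
    rw [iteratedDeriv_mgf_zero (by simp [integrableExpSet_id_gaussianReal])]
    rfl
  rw [← hmoment, ← hmoment, iteratedDeriv_mgf_id_gaussianReal]
  ring

theorem integral_pow_two_mul_gaussianReal (v : ℝ≥0) (k : ℕ) :
    (∫ y, y ^ (2 * k) ∂gaussianReal 0 v) / (2 * k).factorial = (v / 2 : ℝ) ^ k / k.factorial := by
  induction k with
  | zero => simp
  | succ k ih =>
    rw [div_eq_iff (by positivity)] at ih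
    rw [Nat.mul_succ, integral_pow_add_two_gaussianReal, ih, Nat.factorial_succ,
      Nat.factorial_succ, Nat.factorial_succ, pow_succ]
    push_cast
    field_simp
    ring

theorem tendsto_moment_gaussianReal {ι : Type*} {l : Filter ι} {m : ι → ℕ → ℝ}
    (h0 : ∀ n, m n 0 = 1) (h1 : ∀ n, m n 1 = 0) (h2 : Tendsto (fun n => m n 2) l (𝓝 v))
    (hcum : ∀ r, 3 ≤ r → Tendsto (fun n => cumulantOfMoments (m n) r) l (𝓝 0)) (r : ℕ) :
    Tendsto (fun n => m n r) l (𝓝 (∫ y, y ^ r ∂gaussianReal 0 v)) := by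
  have hlim : ∀ i, i ≠ 0 → Tendsto (fun n => cumulantOfMoments (m n) i) l
      (𝓝 (if i = 2 then (v : ℝ) else 0)) := by
    intro i hi
    obtain rfl | rfl | h3 : i = 1 ∨ i = 2 ∨ 3 ≤ i := by lia
    · have hone (n) : cumulantOfMoments (m n) 1 = 0 := by
        simpa [h0, h1] using sum_choose_mul_cumulantOfMoments_mul (m n) (h0 n) 0
      simpa [hone] using tendsto_const_nhds
    · have htwo (n) : cumulantOfMoments (m n) 2 = m n 2 := by
        simpa [h0, h1, Finset.sum_range_succ] using
          sum_choose_mul_cumulantOfMoments_mul (m n) (h0 n) 1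
      simpa [htwo] using h2
    · simpa [show i ≠ 2 by lia] using hcum i h3
  induction r using Nat.strong_induction_on with
  | _ r ih =>
  match r, ih with
  | 0, _ => simpa [h0] using tendsto_const_nhds
  | 1, _ => simpa [h1] using tendsto_const_nhds
  | r + 2, ih =>
    have hsum := tendsto_finsetSum (Finset.range (r + 1 + 1)) fun j hj =>
      (((hlim (r + 1 + 1 - j) (by have := Finset.mem_range.1 hj; lia)).mul
        (ih j (Finset.mem_range.1 hj))).const_mul ((r + 1).choose j : ℝ))
    simp_rw [fun n => sum_choose_mul_cumulantOfMoments_mul (m n) (h0 n) (r + 1)] at hsum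
    rw [Finset.sum_eq_single_of_mem r (by simp) fun j hj hjr => by
      rw [if_neg (by have := Finset.mem_range.1 hj; lia)]; ring] at hsum
    convert! hsum using 2
    rw [integral_pow_add_two_gaussianReal, if_pos (by lia), Nat.choose_succ_self_right]
    push_cast
    ring

end GaussianMoments

section MethodOfMoments

open Complex

theorem hasDerivAt_exp_sub_sum (N : ℕ) (z : ℂ) :
    HasDerivAt (fun z => exp z - ∑ k ∈ Finset.range (N + 1), z ^ k / (k.factorial : ℂ))
      (exp z - ∑ k ∈ Finset.range N, z ^ k / (k.factorial : ℂ)) z := by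
  convert! (hasDerivAt_exp z).sub (HasDerivAt.fun_sum fun k (_ : k ∈ Finset.range (N + 1)) =>
    (hasDerivAt_pow k z).div_const (k.factorial : ℂ)) using 2
  rw [Finset.sum_range_succ']
  simp only [Nat.cast_zero, zero_mul, zero_div, add_zero, Nat.add_sub_cancel]
  refine Finset.sum_congr rfl fun k _ => ?_
  rw [Nat.factorial_succ]
  push_cast
  field_simp

theorem norm_exp_mul_I_sub_sum_le_of_nonneg (N : ℕ) {y : ℝ} (hy : 0 ≤ y) :
    ‖exp (y * I) - ∑ k ∈ Finset.range N, (y * I) ^ k / (k.factorial : ℂ)‖ ≤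
      y ^ N / N.factorial := by
  induction N generalizing y with
  | zero => simp [norm_exp_ofReal_mul_I]
  | succ N ih =>
    have hrem (x : ℝ) : HasDerivAt (fun y : ℝ => exp (y * I) -
        ∑ k ∈ Finset.range (N + 1), (y * I) ^ k / (k.factorial : ℂ))
        ((exp (x * I) - ∑ k ∈ Finset.range N, (x * I) ^ k / (k.factorial : ℂ)) * I) x := by
      have hlin : HasDerivAt (fun y : ℝ => (y : ℂ) * I) I x := by
        simpa using (hasDerivAt_id x).ofReal_comp.mul_const I
      exact (hasDerivAt_exp_sub_sum N (x * I)).comp x hlin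
    have hbound (x : ℝ) : HasDerivAt (fun y : ℝ => y ^ (N + 1) / ((N + 1).factorial : ℝ))
        (x ^ N / N.factorial) x := by
      convert! (hasDerivAt_pow (N + 1) x).div_const ((N + 1).factorial : ℝ) using 1
      rw [Nat.factorial_succ]
      push_cast
      field_simp
    refine image_norm_le_of_norm_deriv_right_le_deriv_boundary' (a := 0) (b := y)
      (fun x _ => (hrem x).continuousAt.continuousWithinAt)
      (fun x _ => (hrem x).hasDerivWithinAt) (by simp [Finset.sum_range_succ'])
      (fun x _ => (hbound x).continuousAt.continuousWithinAt)
      (fun x _ => (hbound x).hasDerivWithinAt) (fun x hx => ?_) ⟨hy, le_rfl⟩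
    rw [norm_mul, norm_I, mul_one]
    exact ih hx.1

theorem norm_exp_mul_I_sub_sum_le (N : ℕ) (y : ℝ) :
    ‖exp (y * I) - ∑ k ∈ Finset.range N, (y * I) ^ k / (k.factorial : ℂ)‖ ≤
      |y| ^ N / N.factorial := by
  obtain hy | hy := le_total 0 y
  · rw [abs_of_nonneg hy]
    exact norm_exp_mul_I_sub_sum_le_of_nonneg N hy
  · rw [abs_of_nonpos hy, ← norm_conj]
    simpa [← exp_conj] using norm_exp_mul_I_sub_sum_le_of_nonneg N (neg_nonneg.2 hy)

variable {Ω Ω' : Type*} [MeasurableSpace Ω] [MeasurableSpace Ω'] {μ : Measure Ω} {ν : Measure Ω'}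

theorem norm_integral_exp_sub_sum_moments_le {Y : Ω → ℝ}
    (hY : ∀ r : ℕ, Integrable (fun x => Y x ^ r) μ) (K : ℕ) :
    ‖∫ x, exp (Y x * I) ∂μ -
        ∑ j ∈ Finset.range (2 * K), I ^ j / (j.factorial : ℂ) * ((∫ x, Y x ^ j ∂μ : ℝ) : ℂ)‖ ≤
      (∫ x, Y x ^ (2 * K) ∂μ) / (2 * K).factorial := by
  have : IsFiniteMeasure μ := by simpa [integrable_const_iff] using hY 0
  have hterm (j : ℕ) (x : Ω) : (Y x * I) ^ j / (j.factorial : ℂ) =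
      I ^ j / (j.factorial : ℂ) * ((Y x ^ j : ℝ) : ℂ) := by
    push_cast
    ring
  have hint (j : ℕ) : Integrable (fun x => (Y x * I) ^ j / (j.factorial : ℂ)) μ := by
    simp_rw [hterm]
    exact (hY j).ofReal.const_mul _
  have hexp : Integrable (fun x => exp (Y x * I)) μ := by
    have hmeas : AEMeasurable Y μ := by simpa using (hY 1).aemeasurable
    exact Integrable.of_bound (AEMeasurable.aestronglyMeasurable (by fun_prop)) 1
      (ae_of_all _ fun x => (norm_exp_ofReal_mul_I _).le)
  have hsum : ∑ j ∈ Finset.range (2 * K), I ^ j / (j.factorial : ℂ) *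
      ((∫ x, Y x ^ j ∂μ : ℝ) : ℂ) =
      ∫ x, ∑ j ∈ Finset.range (2 * K), (Y x * I) ^ j / (j.factorial : ℂ) ∂μ := by
    rw [integral_finsetSum _ fun j _ => hint j]
    simp_rw [hterm, integral_const_mul, integral_complex_ofReal]
  rw [hsum, ← integral_sub hexp (integrable_finsetSum _ fun j _ => hint j), ← integral_div]
  refine norm_integral_le_of_norm_le ((hY _).div_const _) (ae_of_all _ fun x => ?_)
  simpa only [pow_mul, sq_abs] using norm_exp_mul_I_sub_sum_le (2 * K) (Y x)

theorem tendsto_integral_exp_of_tendsto_moments {ι : Type*} {l : Filter ι} {Y : ι → Ω → ℝ}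
    {Z : Ω' → ℝ} (hY : ∀ n (r : ℕ), Integrable (fun x => Y n x ^ r) μ)
    (hZ : ∀ r : ℕ, Integrable (fun x => Z x ^ r) ν)
    (htail : Tendsto (fun K : ℕ => (∫ x, Z x ^ (2 * K) ∂ν) / (2 * K).factorial) atTop (𝓝 0))
    (hmom : ∀ r : ℕ, Tendsto (fun n => ∫ x, Y n x ^ r ∂μ) l (𝓝 (∫ x, Z x ^ r ∂ν))) :
    Tendsto (fun n => ∫ x, exp (Y n x * I) ∂μ) l (𝓝 (∫ x, exp (Z x * I) ∂ν)) := by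
  rw [Metric.tendsto_nhds]
  intro ε hε
  obtain ⟨K, hK⟩ := (htail.eventually (gt_mem_nhds (show 0 < ε / 3 by positivity))).exists
  have hmain := tendsto_finsetSum (Finset.range (2 * K)) fun j _ =>
    ((continuous_ofReal.tendsto _).comp (hmom j)).const_mul (I ^ j / (j.factorial : ℂ))
  filter_upwards [((hmom (2 * K)).div_const _).eventually (gt_mem_nhds hK),
    Metric.tendsto_nhds.1 hmain (ε / 3) (by positivity)] with n hn hdist
  have hYn := (norm_integral_exp_sub_sum_moments_le (hY n) K).trans_lt hn
  have hZK := (norm_integral_exp_sub_sum_moments_le hZ K).trans_lt hK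
  rw [← dist_eq_norm] at hYn
  rw [← dist_eq_norm, dist_comm] at hZK
  calc dist (∫ x, exp (Y n x * I) ∂μ) (∫ x, exp (Z x * I) ∂ν)
      ≤ _ + _ + _ := dist_triangle4 _ _ _ _
    _ < ε / 3 + ε / 3 + ε / 3 := add_lt_add (add_lt_add hYn hdist) hZK
    _ = ε := by ring

end MethodOfMoments

section MethodOfCumulants

open scoped RealInnerProductSpace

variable {Ω : Type*} [MeasurableSpace Ω] {μ : Measure Ω} [IsProbabilityMeasure μ]

theorem cumulant_const (μ : Measure Ω) (Y : Ω → ℝ) (r : ℕ) :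
    cumulant μ (fun _ : Fin r => Y) = cumulantOfMoments (fun j => ∫ x, Y x ^ j ∂μ) r := by
  simp only [cumulant, cumulantOfMoments, partitionCumulant, cumulantCoeff, Finset.prod_const]

theorem integrable_pow_of_memLp {Y : Ω → ℝ} (hY : ∀ r : ℕ, MemLp Y r μ) (r : ℕ) :
    Integrable (fun x => Y x ^ r) μ := by
  have hnorm := (hY r).integrable_norm_pow'
  simp_rw [← norm_pow] at hnorm
  exact (integrable_norm_iff ((hY r).aestronglyMeasurable.pow r)).1 hnorm

theorem tendsto_integral_exp_of_tendsto_cumulant {ι : Type*} {l : Filter ι} {Y : ι → Ω → ℝ}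
    {v : ℝ} (hv : 0 ≤ v) (hY : ∀ n (r : ℕ), MemLp (Y n) r μ) (hmean : ∀ n, ∫ x, Y n x ∂μ = 0)
    (hvar : Tendsto (fun n => ∫ x, Y n x ^ 2 ∂μ) l (𝓝 v))
    (hcum : ∀ r, 3 ≤ r → Tendsto (fun n => cumulant μ fun _ : Fin r => Y n) l (𝓝 0)) :
    Tendsto (fun n => ∫ x, Complex.exp (Y n x * Complex.I) ∂μ) l (𝓝 (Complex.exp (-v / 2))) := by
  lift v to NNReal using hv
  have hmom := tendsto_moment_gaussianReal (m := fun n j => ∫ x, Y n x ^ j ∂μ) (by simp)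
    (by simpa using hmean) hvar (by simpa only [cumulant_const] using hcum)
  have htail := (FloorSemiring.tendsto_pow_div_factorial_atTop (v / 2 : ℝ)).congr fun k =>
    (integral_pow_two_mul_gaussianReal v k).symm
  have hgauss : ∫ y, Complex.exp (y * Complex.I) ∂gaussianReal 0 v = Complex.exp (-v / 2) := by
    simpa [charFun_apply_real, neg_div] using charFun_gaussianReal (μ := 0) (v := v) 1
  exact hgauss ▸ tendsto_integral_exp_of_tendsto_moments (Z := id)
    (fun n => integrable_pow_of_memLp (hY n))
    (integrable_pow_of_memLp fun r => memLp_id_gaussianReal r) htail hmom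

theorem tendstoInDistribution_multivariateGaussian {ι : Type*} [Fintype ι] [DecidableEq ι]
    {Z : ℕ → Ω → EuclideanSpace ℝ ι} {S : Matrix ι ι ℝ} (hS : S.PosSemidef)
    (hZ : ∀ n (r : ℕ), MemLp (Z n) r μ) (hmean : ∀ n a, ∫ x, ⟪a, Z n x⟫ ∂μ = 0)
    (hvar : ∀ a : EuclideanSpace ℝ ι,
      Tendsto (fun n => ∫ x, ⟪a, Z n x⟫ ^ 2 ∂μ) atTop (𝓝 (a ⬝ᵥ S.mulVec a)))
    (hcum : ∀ (a : EuclideanSpace ℝ ι) (r : ℕ), 3 ≤ r →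
      Tendsto (fun n => cumulant μ fun (_ : Fin r) x => ⟪a, Z n x⟫) atTop (𝓝 0)) :
    TendstoInDistribution Z atTop id (fun _ => μ) (multivariateGaussian 0 S) := by
  have hmeas (n : ℕ) : AEMeasurable (Z n) μ := (hZ n 0).aestronglyMeasurable.aemeasurable
  refine ⟨hmeas, aemeasurable_id, ProbabilityMeasure.tendsto_iff_tendsto_charFun.2 fun a => ?_⟩
  have hlim := tendsto_integral_exp_of_tendsto_cumulant
    (by simpa using hS.dotProduct_mulVec_nonneg a) (fun n r => (hZ n r).const_inner a)
    (hmean · a) (hvar a) (hcum a)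
  simp only [ProbabilityMeasure.coe_mk, Measure.map_id, charFun_multivariateGaussian hS]
  convert! hlim using 2 with n
  · rw [charFun_apply, integral_map (hmeas n) (by fun_prop)]
    simp_rw [real_inner_comm]
  · simp [neg_div]

end MethodOfCumulants

section SeriesOfBoundedVariables

variable {𝕜 : Type*} [RCLike 𝕜] {ι : Type*} {r : ℕ}

theorem hasSum_prod_fin {v : Fin r → ι → 𝕜} (hv : ∀ k, Summable fun i => ‖v k i‖) :
    (Summable fun l : Fin r → ι => ‖∏ k, v k (l k)‖) ∧
      HasSum (fun l : Fin r → ι => ∏ k, v k (l k)) (∏ k, ∑' i, v k i) := by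
  induction r with
  | zero => exact ⟨(hasSum_fintype _).summable, by simp⟩
  | succ r ih =>
    obtain ⟨hnorm, hsum⟩ := ih fun k => hv k.succ
    have hmul := (hv 0).mul_norm hnorm
    have hcons (p : ι × (Fin r → ι)) : ∏ k, v k (Fin.consEquiv (fun _ => ι) p k) =
        v 0 p.1 * ∏ k : Fin r, v k.succ (p.2 k) := by
      simp only [Fin.prod_univ_succ, Fin.consEquiv, Equiv.coe_fn_mk, Fin.cons_zero, Fin.cons_succ]
    refine ⟨(Fin.consEquiv fun _ => ι).summable_iff.1 (hmul.congr fun p => ?_),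
      (Fin.consEquiv fun _ => ι).hasSum_iff.1 ?_⟩
    · rw [Function.comp_apply, hcons]
    · rw [Fin.prod_univ_succ]
      exact ((hv 0).of_norm.hasSum.mul hsum hmul.of_norm).congr_fun hcons

variable [Countable ι] {Ω : Type*} [MeasurableSpace Ω] {μ : Measure Ω}

theorem hasSum_integral_prod [IsFiniteMeasure μ] {Z : Fin r → ι → Ω → 𝕜} {b : Fin r → ι → ℝ}
    (hZ : ∀ k i, AEStronglyMeasurable (Z k i) μ) (hb : ∀ k, Summable (b k))
    (hZb : ∀ k i, ∀ᵐ x ∂μ, ‖Z k i x‖ ≤ b k i) :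
    HasSum (fun l : Fin r → ι => ∫ x, ∏ k, Z k (l k) x ∂μ) (∫ x, ∏ k, ∑' i, Z k i x ∂μ) := by
  have hbound : ∀ᵐ x ∂μ, ∀ k i, ‖Z k i x‖ ≤ b k i := ae_all_iff.2 fun k => ae_all_iff.2 (hZb k)
  refine hasSum_integral_of_dominated_convergence (fun l _ => ‖∏ k, b k (l k)‖) (fun l => ?_)
    (fun l => ?_) (ae_of_all _ fun _ => (hasSum_prod_fin fun k => (hb k).norm).1)
    (integrable_const _) ?_
  · exact Finset.aestronglyMeasurable_fun_prod _ fun k _ => hZ k (l k)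
  · filter_upwards [hbound] with x hx
    rw [norm_prod, norm_prod]
    exact Finset.prod_le_prod (fun _ _ => norm_nonneg _) fun k _ =>
      (hx k (l k)).trans (le_abs_self _)
  · filter_upwards [hbound] with x hx
    exact (hasSum_prod_fin fun k => (hb k).of_nonneg_of_le (fun _ => norm_nonneg _) (hx k)).2

theorem hasSum_integral_tsum_mul_tsum [IsFiniteMeasure μ] {Y Z : ι → Ω → 𝕜} {a b : ι → ℝ}
    (hY : ∀ i, AEStronglyMeasurable (Y i) μ) (hZ : ∀ i, AEStronglyMeasurable (Z i) μ)
    (ha : Summable a) (hb : Summable b) (hYa : ∀ i, ∀ᵐ x ∂μ, ‖Y i x‖ ≤ a i)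
    (hZb : ∀ i, ∀ᵐ x ∂μ, ‖Z i x‖ ≤ b i) :
    HasSum (fun l : Fin 2 → ι => ∫ x, Y (l 0) x * Z (l 1) x ∂μ)
      (∫ x, (∑' i, Y i x) * ∑' i, Z i x ∂μ) := by
  simpa only [Fin.prod_univ_two, Matrix.cons_val_zero, Matrix.cons_val_one,
    Matrix.cons_val_fin_one] using hasSum_integral_prod (μ := μ) (Z := ![Y, Z]) (b := ![a, b])
      (Fin.forall_fin_two.2 ⟨hY, hZ⟩) (Fin.forall_fin_two.2 ⟨ha, hb⟩)
      (Fin.forall_fin_two.2 ⟨hYa, hZb⟩)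

/-- Taking one independent copy of `Ω` per block reduces the summability of the terms of a cumulant
to that of a single family of integrals. -/
theorem prod_integral_parts [SigmaFinite μ]
    (P : Finpartition (Finset.univ : Finset (Fin r))) (X : Fin r → Ω → ℝ) :
    ∏ I ∈ P.parts, ∫ x, ∏ i ∈ I, X i x ∂μ =
      ∫ ω, ∏ k, X k (ω ⟨P.part k, P.part_mem.2 (Finset.mem_univ k)⟩)
        ∂(Measure.pi fun _ : P.parts => μ) := by
  let block (k : Fin r) : P.parts := ⟨P.part k, P.part_mem.2 (Finset.mem_univ k)⟩
  have hblock {k : Fin r} {I : P.parts} : block k = I ↔ k ∈ I.1 :=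
    Subtype.ext_iff.trans (P.part_eq_iff_mem I.2)
  have hprod (ω : P.parts → Ω) : ∏ k, X k (ω (block k)) =
      ∏ I : P.parts, ∏ i ∈ I.1, X i (ω I) := by
    rw [← Finset.prod_fiberwise Finset.univ block]
    refine Finset.prod_congr rfl fun I _ => ?_
    refine Finset.prod_congr (by ext k; simp [hblock]) fun k hk => ?_
    rw [hblock.2 hk]
  change _ = ∫ ω : P.parts → Ω, ∏ k, X k (ω (block k)) ∂(Measure.pi fun _ => μ)
  simp_rw [hprod]
  rw [integral_fintype_prod_eq_prod (fun (I : P.parts) x => ∏ i ∈ I.1, X i x),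
    Finset.prod_coe_sort P.parts fun I => ∫ x, ∏ i ∈ I, X i x ∂μ]

theorem cumulant_const_mul [SigmaFinite μ] (a : Fin r → ℝ) (X : Fin r → Ω → ℝ) :
    cumulant μ (fun k x => a k * X k x) = (∏ k, a k) * cumulant μ X := by
  simp only [cumulant, prod_integral_parts]
  simp only [Finset.prod_mul_distrib, integral_const_mul, Finset.mul_sum]
  exact Finset.sum_congr rfl fun P _ => mul_left_comm _ _ _

theorem hasSum_cumulant [IsProbabilityMeasure μ] {X : Fin r → ι → Ω → ℝ} {b : Fin r → ι → ℝ}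
    (hX : ∀ k i, AEStronglyMeasurable (X k i) μ) (hb : ∀ k, Summable (b k))
    (hXb : ∀ k i, ∀ᵐ x ∂μ, ‖X k i x‖ ≤ b k i) :
    HasSum (fun l : Fin r → ι => cumulant μ fun k => X k (l k))
      (cumulant μ fun k x => ∑' i, X k i x) := by
  simp only [cumulant]
  refine hasSum_sum fun P _ => HasSum.mul_left _ ?_
  simp only [prod_integral_parts]
  have hcopy (I : P.parts) : MeasurePreserving (Function.eval I)
      (Measure.pi fun _ : P.parts => μ) μ := measurePreserving_eval (fun _ => μ) I
  exact hasSum_integral_prod (μ := Measure.pi fun _ : P.parts => μ)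
    (Z := fun k i ω => X k i (ω ⟨P.part k, P.part_mem.2 (Finset.mem_univ k)⟩))
    (fun k i => (hX k i).comp_measurePreserving (hcopy _)) hb
    fun k i => (hcopy _).quasiMeasurePreserving.ae (hXb k i)

end SeriesOfBoundedVariables

section FourierSeries

open UnitAddTorus ComplexConjugate

variable {d : ℕ}

instance : IsProbabilityMeasure (torusMeasure d) :=
  inferInstanceAs (IsProbabilityMeasure (Measure.pi fun _ : Fin d => AddCircle.haarAddCircle))

theorem integrable_torusMeasure_of_continuous {F : Type*} [NormedAddCommGroup F] {g : Torus d → F}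
    (hg : Continuous g) : Integrable g (torusMeasure d) :=
  hg.integrable_of_hasCompactSupport (HasCompactSupport.of_compactSpace g)

theorem norm_mFourier_apply (k : Lattice d) (t : Torus d) : ‖mFourier k t‖ = 1 := by
  simp only [mFourier, ContinuousMap.coe_mk, norm_prod, fourier_apply, Circle.norm_coe,
    Finset.prod_const_one]

theorem integral_fourier (n : ℤ) :
    ∫ t : UnitAddCircle, fourier n t ∂AddCircle.haarAddCircle = if n = 0 then 1 else 0 := by
  split_ifs with h
  · simp [h]
  · exact integral_eq_zero_of_add_right_eq_neg (μ := AddCircle.haarAddCircle)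
      (fourier_add_half_inv_index h one_pos)

theorem integral_mFourier (k : Lattice d) :
    ∫ t, mFourier k t ∂torusMeasure d = if k = 0 then 1 else 0 := by
  have hprod : ∫ t, mFourier k t ∂torusMeasure d =
      ∏ i, ∫ t : UnitAddCircle, fourier (k i) t ∂AddCircle.haarAddCircle :=
    integral_fintype_prod_eq_prod fun i (t : UnitAddCircle) => (fourier (k i) t : ℂ)
  simp_rw [hprod, integral_fourier, Finset.prod_ite_zero, Finset.prod_const_one, funext_iff,
    Finset.mem_univ, true_imp_iff, Pi.zero_apply]

theorem norm_ofReal_mul_mFourier (a : ℝ) (k : Lattice d) (t : Torus d) :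
    ‖(a : ℂ) * mFourier k t‖ = |a| := by
  rw [norm_mul, norm_mFourier_apply, mul_one, Complex.norm_real, Real.norm_eq_abs]

theorem conj_trigSum (v : Lattice d → ℝ) (t : Torus d) :
    conj (trigSum v t) = trigSum (fun l => v (-l)) t := by
  rw [trigSum, Complex.conj_tsum, trigSum, ← (Equiv.neg (Lattice d)).tsum_eq]
  simp only [map_mul, Complex.conj_ofReal, Equiv.neg_apply, mFourier_neg, Complex.conj_conj]

theorem summable_abs_neg {v : Lattice d → ℝ} (hv : Summable fun l => |v l|) :
    Summable fun l => |v (-l)| :=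
  (Equiv.neg (Lattice d)).summable_iff.2 hv

variable {u v c : Lattice d → ℝ}

theorem continuous_trigSum (hv : Summable fun l => |v l|) : Continuous (trigSum v) :=
  continuous_tsum (fun _ => by fun_prop) hv fun l t => (norm_ofReal_mul_mFourier (v l) l t).le

theorem continuous_trigSum_mul_conj (hu : Summable fun l => |u l|)
    (hv : Summable fun l => |v l|) : Continuous fun t => trigSum u t * conj (trigSum v t) :=
  (continuous_trigSum hu).mul (continuous_trigSum hv).star

theorem hasSum_integral_mul_trigSum (hv : Summable fun l => |v l|) {g : Torus d → ℂ}
    (hg : Integrable g (torusMeasure d)) :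
    HasSum (fun k => (v k : ℂ) * ∫ t, g t * mFourier k t ∂torusMeasure d)
      (∫ t, g t * trigSum v t ∂torusMeasure d) := by
  have hnorm (k : Lattice d) (t : Torus d) :
      ‖g t * ((v k : ℂ) * mFourier k t)‖ = ‖g t‖ * |v k| := by
    rw [norm_mul, norm_ofReal_mul_mFourier]
  have hint (k : Lattice d) : Integrable (fun t => g t * ((v k : ℂ) * mFourier k t))
      (torusMeasure d) :=
    hg.mul_bdd (by fun_prop) (ae_of_all _ fun t => (norm_ofReal_mul_mFourier (v k) k t).le)
  have hsum := hasSum_integral_of_summable_integral_norm hint (by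
    simpa only [hnorm, integral_mul_const] using hv.mul_left _)
  simp only [tsum_mul_left] at hsum
  refine hsum.congr_fun fun k => ?_
  rw [← integral_const_mul]
  simp only [mul_left_comm]

theorem integral_mFourier_mul_trigSum (hv : Summable fun l => |v l|) (k : Lattice d) :
    ∫ t, mFourier k t * trigSum v t ∂torusMeasure d = v (-k) := by
  refine (hasSum_integral_mul_trigSum hv
    (integrable_torusMeasure_of_continuous (mFourier k).continuous)).unique ?_
  simp only [← mFourier_add, integral_mFourier, mul_ite, mul_one, mul_zero,
    add_eq_zero_iff_neg_eq]
  convert! hasSum_ite_eq (-k) (v (-k) : ℂ) using 2 with p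
  split_ifs with h <;> simp_all

theorem integral_norm_sq_trigSum (hv : Summable fun l => |v l|) :
    ∫ t, ‖trigSum v t‖ ^ 2 ∂torusMeasure d = sqSum v := by
  have hsum := hasSum_integral_mul_trigSum hv
    (integrable_torusMeasure_of_continuous (continuous_trigSum (summable_abs_neg hv)))
  have hcoef (k : Lattice d) :
      ∫ t, trigSum (fun l => v (-l)) t * mFourier k t ∂torusMeasure d = v k := by
    simp_rw [mul_comm _ (mFourier k _)]
    rw [integral_mFourier_mul_trigSum (summable_abs_neg hv), neg_neg]
  simp_rw [hcoef, ← conj_trigSum, Complex.conj_mul', ← sq] at hsum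
  rw [← Complex.ofReal_inj, ← integral_complex_ofReal, sqSum, Complex.ofReal_tsum]
  simpa only [Complex.ofReal_pow] using hsum.tsum_eq.symm

theorem norm_integral_trigSum_mul_conj_le (hu : Summable fun l => |u l|)
    (hv : Summable fun l => |v l|) (p : Lattice d) :
    ‖∫ t, trigSum u t * conj (trigSum v t) * mFourier p t ∂torusMeasure d‖ ≤
      sqSum u + sqSum v := by
  have hint {v : Lattice d → ℝ} (hv : Summable fun l => |v l|) :
      Integrable (fun t => ‖trigSum v t‖ ^ 2) (torusMeasure d) :=
    integrable_torusMeasure_of_continuous ((continuous_trigSum hv).norm.pow 2)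
  rw [← integral_norm_sq_trigSum hu, ← integral_norm_sq_trigSum hv,
    ← integral_add (hint hu) (hint hv)]
  refine norm_integral_le_of_norm_le ((hint hu).add (hint hv)) (ae_of_all _ fun t => ?_)
  rw [norm_mul, norm_mul, norm_mFourier_apply, mul_one, Complex.norm_conj]
  nlinarith [two_mul_le_add_sq ‖trigSum u t‖ ‖trigSum v t‖, sq_nonneg ‖trigSum u t‖,
    sq_nonneg ‖trigSum v t‖]

theorem exists_continuousMap_eq_trigSum (hc : Summable fun k => |c k|)
    (hneg : ∀ k, c (-k) = c k) : ∃ φ : C(Torus d, ℝ), ∀ t, (φ t : ℂ) = trigSum c t := by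
  refine ⟨⟨fun t => (trigSum c t).re, Complex.continuous_re.comp (continuous_trigSum hc)⟩,
    fun t => Complex.conj_eq_iff_re.1 ?_⟩
  rw [conj_trigSum]
  simp only [hneg]

theorem isLittleO_integral_trigSum_mul_conj {u v : ℕ → Lattice d → ℝ}
    (hu : ∀ n, Summable fun l => |u n l|) (hv : ∀ n, Summable fun l => |v n l|)
    (horth : ∀ p, (fun n => ∫ t, trigSum (u n) t * conj (trigSum (v n) t) * mFourier p t
      ∂torusMeasure d) =o[atTop] fun n => sqSum (u n) + sqSum (v n))
    (hc : Summable fun k => |c k|) :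
    (fun n => ∫ t, trigSum (u n) t * conj (trigSum (v n) t) * trigSum c t ∂torusMeasure d)
      =o[atTop] fun n => sqSum (u n) + sqSum (v n) := by
  have hsum (n : ℕ) := hasSum_integral_mul_trigSum hc (integrable_torusMeasure_of_continuous
    (continuous_trigSum_mul_conj (hu n) (hv n)))
  have hzero (n : ℕ) (p : Lattice d) (h : sqSum (u n) + sqSum (v n) = 0) :
      ∫ t, trigSum (u n) t * conj (trigSum (v n) t) * mFourier p t ∂torusMeasure d = 0 :=
    norm_le_zero_iff.1 (h ▸ norm_integral_trigSum_mul_conj_le (hu n) (hv n) p)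
  rw [← Complex.isLittleO_ofReal_right, isLittleO_iff_tendsto fun n h => ?_]
  · simp_rw [← (hsum _).tsum_eq, ← tsum_div_const, mul_div_assoc]
    rw [← tsum_zero (α := ℂ) (β := Lattice d)]
    refine tendsto_tsum_of_dominated_convergence hc (fun p => ?_)
      (Eventually.of_forall fun n p => ?_)
    · simpa using (Complex.isLittleO_ofReal_right.2 (horth p)).tendsto_div_nhds_zero.const_mul
        (c p : ℂ)
    · rw [norm_mul, Complex.norm_real, Real.norm_eq_abs, norm_div, Complex.norm_real]
      exact mul_le_of_le_one_right (abs_nonneg _) (div_le_one_of_le₀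
        ((norm_integral_trigSum_mul_conj_le (hu n) (hv n) p).trans (le_abs_self _))
        (norm_nonneg _))
  · rw [← (hsum n).tsum_eq]
    simp only [hzero n _ (Complex.ofReal_eq_zero.1 h), mul_zero, tsum_zero]

end FourierSeries

section WeightedSeries

variable {ι Ω : Type*} [MeasurableSpace Ω] {μ : Measure Ω} {X : ι → Ω → ℝ} {M : ℝ}

theorem ae_norm_mul_le (hM : ∀ i, ∀ᵐ x ∂μ, ‖X i x‖ ≤ M) (v : ι → ℝ) (i : ι) :
    ∀ᵐ x ∂μ, ‖v i * X i x‖ ≤ |v i| * M :=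
  (hM i).mono fun x hx => by
    rw [norm_mul, Real.norm_eq_abs]
    exact mul_le_mul_of_nonneg_left hx (abs_nonneg _)

variable [Countable ι]

theorem aestronglyMeasurable_tsum_mul (hX : ∀ i, AEStronglyMeasurable (X i) μ) (v : ι → ℝ) :
    AEStronglyMeasurable (fun x => ∑' i, v i * X i x) μ :=
  (AEMeasurable.tsum fun i => (hX i).aemeasurable.const_mul _).aestronglyMeasurable

theorem ae_norm_tsum_mul_le (hM : ∀ i, ∀ᵐ x ∂μ, ‖X i x‖ ≤ M) {v : ι → ℝ}
    (hv : Summable fun i => |v i|) :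
    ∀ᵐ x ∂μ, ‖∑' i, v i * X i x‖ ≤ (∑' i, |v i|) * M :=
  (ae_all_iff.2 (ae_norm_mul_le hM v)).mono fun _ hx =>
    tsum_of_norm_bounded (hv.hasSum.mul_right M) hx

variable [IsProbabilityMeasure μ]

theorem integral_tsum_mul_eq_zero (hX : ∀ i, AEStronglyMeasurable (X i) μ)
    (hM : ∀ i, ∀ᵐ x ∂μ, ‖X i x‖ ≤ M) (hX0 : ∀ i, ∫ x, X i x ∂μ = 0) {v : ι → ℝ}
    (hv : Summable fun i => |v i|) : ∫ x, ∑' i, v i * X i x ∂μ = 0 := by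
  have hsum := hasSum_integral_prod (μ := μ) (Z := fun (_ : Fin 1) i x => v i * X i x)
    (fun _ i => (hX i).const_mul _) (fun _ => hv.mul_right M) fun _ => ae_norm_mul_le hM v
  simp only [Fin.prod_univ_one, integral_const_mul, hX0, mul_zero] at hsum
  exact hsum.unique hasSum_zero

theorem hasSum_cumulant_tsum_mul (hX : ∀ i, AEStronglyMeasurable (X i) μ)
    (hM : ∀ i, ∀ᵐ x ∂μ, ‖X i x‖ ≤ M) {r : ℕ} {v : Fin r → ι → ℝ}
    (hv : ∀ k, Summable fun i => |v k i|) :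
    HasSum (fun l : Fin r → ι => (∏ k, v k (l k)) * cumulant μ fun k => X (l k))
      (cumulant μ fun k x => ∑' i, v k i * X i x) := by
  simp only [← cumulant_const_mul]
  exact hasSum_cumulant (X := fun k i x => v k i * X i x) (fun k i => (hX i).const_mul _)
    (fun k => (hv k).mul_right M) fun k => ae_norm_mul_le hM (v k)

end WeightedSeries

section Covariance

open UnitAddTorus ComplexConjugate

variable {Ω : Type*} [MeasurableSpace Ω] {μ : Measure Ω} {d : ℕ} {X : Lattice d → Ω → ℝ}
  {c : Lattice d → ℝ}

/-- `X` is a uniformly bounded centered random field on `ℤ^d` that is stationary in the wide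
sense, with covariance function `c`. -/
structure IsBoundedStationary (μ : Measure Ω) (X : Lattice d → Ω → ℝ) (c : Lattice d → ℝ) :
    Prop where
  aestronglyMeasurable : ∀ l, AEStronglyMeasurable (X l) μ
  exists_bound : ∃ M, ∀ l, ∀ᵐ x ∂μ, ‖X l x‖ ≤ M
  integral_eq_zero : ∀ l, ∫ x, X l x ∂μ = 0
  integral_mul : ∀ k l, ∫ x, X k x * X l x ∂μ = c (k - l)

theorem IsBoundedStationary.covariance_neg (hX : IsBoundedStationary μ X c) (k : Lattice d) :
    c (-k) = c k := by
  rw [← zero_sub, ← hX.integral_mul, ← sub_zero k, ← hX.integral_mul, sub_zero]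
  simp only [mul_comm]

theorem exists_spectralDensity (hc : Summable fun k => |c k|) (hneg : ∀ k, c (-k) = c k) :
    ∃ φ : C(Torus d, ℝ), (∀ t, (φ t : ℂ) = trigSum c t) ∧
      ∀ k, (c k : ℂ) = ∫ t, mFourier k t * (φ t : ℂ) ∂torusMeasure d := by
  obtain ⟨φ, hφ⟩ := exists_continuousMap_eq_trigSum hc hneg
  refine ⟨φ, hφ, fun k => ?_⟩
  simp only [hφ, integral_mFourier_mul_trigSum hc, hneg]

variable {u v : Lattice d → ℝ}

theorem hasSum_integral_trigSum_mul_conj (hu : Summable fun l => |u l|)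
    (hv : Summable fun l => |v l|) (φ : C(Torus d, ℝ)) :
    HasSum (fun l : Fin 2 → Lattice d => (u (l 0) * v (l 1) : ℂ) *
        ∫ t, mFourier (l 0 - l 1) t * (φ t : ℂ) ∂torusMeasure d)
      (∫ t, trigSum u t * conj (trigSum v t) * (φ t : ℂ) ∂torusMeasure d) := by
  have hsum := hasSum_integral_tsum_mul_tsum (μ := torusMeasure d)
    (Y := fun k t => u k * mFourier k t) (Z := fun l t => v l * mFourier (-l) t * φ t)
    (fun k => Continuous.aestronglyMeasurable (by fun_prop))
    (fun l => Continuous.aestronglyMeasurable (by fun_prop)) hu (hv.mul_right ‖φ‖)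
    (fun k => ae_of_all _ fun _ => (norm_ofReal_mul_mFourier _ _ _).le)
    fun l => ae_of_all _ fun t => ?_
  · convert! hsum using 3 with l
    · rw [← integral_const_mul]
      simp only [sub_eq_add_neg, mFourier_add]
      ring_nf
    · simp only [trigSum, Complex.conj_tsum, map_mul, Complex.conj_ofReal, ← mFourier_neg]
      rw [tsum_mul_right, mul_assoc]
  · rw [norm_mul, norm_ofReal_mul_mFourier, Complex.norm_real]
    exact mul_le_mul_of_nonneg_left (φ.norm_coe_le_norm t) (abs_nonneg _)

theorem IsBoundedStationary.integral_tsum_mul_tsum [IsProbabilityMeasure μ]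
    (hX : IsBoundedStationary μ X c)
    {φ : C(Torus d, ℝ)} (hφ : ∀ k, (c k : ℂ) = ∫ t, mFourier k t * (φ t : ℂ) ∂torusMeasure d)
    (hu : Summable fun l => |u l|) (hv : Summable fun l => |v l|) :
    ((∫ x, (∑' l, u l * X l x) * ∑' l, v l * X l x ∂μ : ℝ) : ℂ) =
      ∫ t, trigSum u t * conj (trigSum v t) * (φ t : ℂ) ∂torusMeasure d := by
  obtain ⟨M, hM⟩ := hX.exists_bound
  have hsum := hasSum_integral_tsum_mul_tsum (fun l => (hX.aestronglyMeasurable l).const_mul (u l))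
    (fun l => (hX.aestronglyMeasurable l).const_mul (v l)) (hu.mul_right M) (hv.mul_right M)
    (ae_norm_mul_le hM u) (ae_norm_mul_le hM v)
  simp only [mul_mul_mul_comm _ (X _ _), integral_const_mul, hX.integral_mul] at hsum
  refine (Complex.hasSum_ofReal.2 hsum).unique
    ((hasSum_integral_trigSum_mul_conj hu hv φ).congr_fun fun l => ?_)
  simp only [Complex.ofReal_mul, hφ]

end Covariance

section Weights

open ComplexConjugate

variable {d s : ℕ}

theorem summable_sq_of_summable_abs {v : Lattice d → ℝ} (hv : Summable fun l => |v l|) :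
    Summable fun l => v l ^ 2 :=
  .of_norm_bounded (hv.mul_left (∑' l, |v l|)) fun l => by
    rw [norm_pow, sq, Real.norm_eq_abs]
    exact mul_le_mul_of_nonneg_right (hv.le_tsum l fun _ _ => abs_nonneg _) (abs_nonneg _)

theorem IsSummationSequence.sqSum_pos {w : ℕ → Lattice d → ℝ} (hw : IsSummationSequence w)
    (n : ℕ) : 0 < sqSum (w n) := by
  obtain ⟨habs, hpos⟩ := hw n
  obtain ⟨l, hl⟩ : ∃ l, w n l ≠ 0 := by
    by_contra! hzero
    simp only [hzero, abs_zero, tsum_zero, lt_irrefl] at hpos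
  exact (summable_sq_of_summable_abs habs).tsum_pos (fun _ => sq_nonneg _) l (by positivity)

theorem isBigO_add_sqrt_mul_sqrt {f g : ℕ → ℝ} (hf : ∀ n, 0 ≤ f n) (hg : ∀ n, 0 ≤ g n)
    (hfg : f =O[atTop] g) (hgf : g =O[atTop] f) :
    (fun n => f n + g n) =O[atTop] fun n => √(f n) * √(g n) := by
  have hf' := (isBigO_refl (fun n => √(f n)) atTop).mul (hfg.sqrt (Eventually.of_forall hg))
  have hg' := (hgf.sqrt (Eventually.of_forall hf)).mul (isBigO_refl (fun n => √(g n)) atTop)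
  simp only [Real.mul_self_sqrt (hf _), Real.mul_self_sqrt (hg _)] at hf' hg'
  exact hf'.add hg'

variable {Ω : Type*} [MeasurableSpace Ω] {μ : Measure Ω} [IsProbabilityMeasure μ]
  {X : Lattice d → Ω → ℝ} {c : Lattice d → ℝ} {φ : C(Torus d, ℝ)}
  {w : Fin s → ℕ → Lattice d → ℝ}

theorem IsBoundedStationary.integral_normalizedSums_mul (hX : IsBoundedStationary μ X c)
    (hφ : ∀ k, (c k : ℂ) = ∫ t, UnitAddTorus.mFourier k t * (φ t : ℂ) ∂torusMeasure d)
    (hw : ∀ j, IsSummationSequence (w j)) (n : ℕ) (j j' : Fin s) :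
    ((∫ x, normalizedSums X w n x j * normalizedSums X w n x j' ∂μ : ℝ) : ℂ) =
      (∫ t, trigSum (w j n) t * conj (trigSum (w j' n) t) * φ t ∂torusMeasure d) /
        ((√(sqSum (w j n)) * √(sqSum (w j' n)) : ℝ) : ℂ) := by
  rw [← hX.integral_tsum_mul_tsum hφ (hw j n).1 (hw j' n).1, ← Complex.ofReal_div, ← integral_div]
  simp only [normalizedSums, div_mul_div_comm]

theorem IsBoundedStationary.integral_normalizedSums_sq (hX : IsBoundedStationary μ X c)
    (hφ : ∀ k, (c k : ℂ) = ∫ t, UnitAddTorus.mFourier k t * (φ t : ℂ) ∂torusMeasure d)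
    (hw : ∀ j, IsSummationSequence (w j)) (n : ℕ) (j : Fin s) :
    ∫ x, normalizedSums X w n x j * normalizedSums X w n x j ∂μ =
      ∫ t, kernel (w j n) t * φ t ∂torusMeasure d := by
  rw [← Complex.ofReal_inj, hX.integral_normalizedSums_mul hφ hw, ← integral_complex_ofReal,
    Real.mul_self_sqrt ((hw j).sqSum_pos n).le, ← integral_div]
  simp only [kernel, Complex.mul_conj', Complex.ofReal_mul, Complex.ofReal_div,
    Complex.ofReal_pow, mul_div_right_comm]

theorem IsBoundedStationary.tendsto_integral_normalizedSums_mul (hX : IsBoundedStationary μ X c)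
    (hc : Summable fun k => |c k|) (hφ : ∀ t, (φ t : ℂ) = trigSum c t)
    (hφc : ∀ k, (c k : ℂ) = ∫ t, UnitAddTorus.mFourier k t * (φ t : ℂ) ∂torusMeasure d)
    {ξ : Fin s → Measure (Torus d)} (hw : ∀ j, IsSummationSequence (w j))
    (hreg : ∀ j, IsRegular (ξ j) (w j))
    (hcomp : ∀ j j', (fun n => sqSum (w j n)) =O[atTop] fun n => sqSum (w j' n))
    (hortho : AsymptoticallyOrthogonal w) (j j' : Fin s) :
    Tendsto (fun n => ∫ x, normalizedSums X w n x j * normalizedSums X w n x j' ∂μ) atTop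
      (𝓝 (if j = j' then ∫ t, φ t ∂ξ j else 0)) := by
  split_ifs with h
  · subst h
    simpa only [hX.integral_normalizedSums_sq hφc hw] using hreg j φ
  · have hsq (j n) : 0 ≤ sqSum (w j n) := ((hw j).sqSum_pos n).le
    have horth (p : Lattice d) := hortho j j' h (-p)
    simp only [neg_neg] at horth
    have hcross := (isLittleO_integral_trigSum_mul_conj (fun n => (hw j n).1)
      (fun n => (hw j' n).1) horth hc).trans_isBigO
      (isBigO_add_sqrt_mul_sqrt (hsq j) (hsq j') (hcomp j j') (hcomp j' j))
    have hlim := (Complex.isLittleO_ofReal_right.2 hcross).tendsto_div_nhds_zero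
    simp only [← hφ, ← hX.integral_normalizedSums_mul hφc hw] at hlim
    exact (Complex.continuous_re.tendsto _).comp hlim

end Weights

section NormalizedSums

open scoped RealInnerProductSpace

variable {Ω : Type*} [MeasurableSpace Ω] {μ : Measure Ω}

section Inner

variable {ι : Type*} [Fintype ι]

theorem inner_eq_sum_mul (a z : EuclideanSpace ℝ ι) : ⟪a, z⟫ = ∑ j, a j * z j := by
  simp only [PiLp.inner_apply, Real.inner_apply]

theorem integral_inner_sq {Z : Ω → EuclideanSpace ℝ ι} (hZ : MemLp Z 2 μ)
    (a : EuclideanSpace ℝ ι) :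
    ∫ x, ⟪a, Z x⟫ ^ 2 ∂μ = ∑ j, ∑ j', a j * a j' * ∫ x, Z x j * Z x j' ∂μ := by
  have hint (j j' : ι) : Integrable (fun x => a j * a j' * (Z x j * Z x j')) μ :=
    ((hZ.eval_piLp j).integrable_mul (hZ.eval_piLp j')).const_mul _
  simp only [inner_eq_sum_mul, sq, Finset.sum_mul_sum, mul_mul_mul_comm (a _) (Z _ _)]
  rw [integral_finsetSum _ fun j _ => integrable_finsetSum _ fun j' _ => hint j j']
  simp only [integral_finsetSum _ fun j' _ => hint _ j', integral_const_mul]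

end Inner

variable [IsProbabilityMeasure μ] {d s : ℕ}
  {X : Lattice d → Ω → ℝ} {c : Lattice d → ℝ} {w : Fin s → ℕ → Lattice d → ℝ}

theorem IsBoundedStationary.memLp_normalizedSums (hX : IsBoundedStationary μ X c)
    (hw : ∀ j, IsSummationSequence (w j)) (n : ℕ) (p : ENNReal) :
    MemLp (normalizedSums X w n) p μ := by
  obtain ⟨M, hM⟩ := hX.exists_bound
  refine .of_eval_piLp fun j => ?_
  simp only [normalizedSums, div_eq_mul_inv]
  exact (MemLp.of_bound (aestronglyMeasurable_tsum_mul hX.aestronglyMeasurable _) _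
    (ae_norm_tsum_mul_le hM (hw j n).1)).mul_const _

theorem IsBoundedStationary.integral_inner_normalizedSums (hX : IsBoundedStationary μ X c)
    (hw : ∀ j, IsSummationSequence (w j)) (n : ℕ) (a : EuclideanSpace ℝ (Fin s)) :
    ∫ x, ⟪a, normalizedSums X w n x⟫ ∂μ = 0 := by
  obtain ⟨M, hM⟩ := hX.exists_bound
  have hint := ((hX.memLp_normalizedSums hw n 1).integrable le_rfl).eval_piLp
  simp only [inner_eq_sum_mul]
  rw [integral_finsetSum _ fun j _ => (hint j).const_mul _]
  refine Finset.sum_eq_zero fun j _ => ?_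
  simp only [normalizedSums, integral_const_mul, integral_div, integral_tsum_mul_eq_zero
    hX.aestronglyMeasurable hM hX.integral_eq_zero (hw j n).1, zero_div, mul_zero]

theorem IsBoundedStationary.cumulant_inner_normalizedSums (hX : IsBoundedStationary μ X c)
    (hw : ∀ j, IsSummationSequence (w j)) (n r : ℕ) (a : EuclideanSpace ℝ (Fin s)) :
    cumulant μ (fun (_ : Fin r) x => ⟪a, normalizedSums X w n x⟫) =
      ∑ i : Fin r → Fin s, (∏ k, a (i k) / √(sqSum (w (i k) n))) *
        ∑' l : Fin r → Lattice d, (∏ k, w (i k) n (l k)) * cumulant μ fun k => X (l k) := by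
  obtain ⟨M, hM⟩ := hX.exists_bound
  obtain ⟨C, hC⟩ := Finite.exists_le fun j => (∑' l, |w j n l|) * M
  have houter := hasSum_cumulant_tsum_mul (μ := μ) (r := r)
    (X := fun j x => ∑' l, w j n l * X l x) (v := fun _ j => a j / √(sqSum (w j n)))
    (fun j => aestronglyMeasurable_tsum_mul hX.aestronglyMeasurable _)
    (fun j => (ae_norm_tsum_mul_le hM (hw j n).1).mono fun x hx => hx.trans (hC j))
    fun _ => (hasSum_fintype _).summable
  have hinner (i : Fin r → Fin s) := hasSum_cumulant_tsum_mul (μ := μ)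
    (v := fun k => w (i k) n) hX.aestronglyMeasurable hM fun k => (hw (i k) n).1
  simp only [(hinner _).tsum_eq]
  rw [(hasSum_fintype _).unique houter]
  simp only [inner_eq_sum_mul, normalizedSums, tsum_fintype, div_mul_eq_mul_div, mul_div_assoc]

theorem isBigO_rpow_sum_sqSum (hw : ∀ j, IsSummationSequence (w j))
    (hcomp : ∀ j j', (fun n => sqSum (w j n)) =O[atTop] fun n => sqSum (w j' n))
    {r : ℕ} (i : Fin r → Fin s) :
    (fun n => (∑' l, ∑ j, w j n l ^ 2) ^ ((r : ℝ) / 2)) =O[atTop]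
      fun n => ∏ k, √(sqSum (w (i k) n)) := by
  have hnonneg (n : ℕ) : 0 ≤ ∑ j, sqSum (w j n) :=
    Finset.sum_nonneg fun j _ => ((hw j).sqSum_pos n).le
  have hsqrt (j : Fin s) :
      (fun n => √(∑ j', sqSum (w j' n))) =O[atTop] fun n => √(sqSum (w j n)) :=
    (IsBigO.fun_sum fun j' _ => hcomp j' j).sqrt
      (Eventually.of_forall fun n => ((hw j).sqSum_pos n).le)
  refine (IsBigO.finsetProd fun k _ => hsqrt (i k)).congr_left fun n => ?_
  rw [Summable.tsum_finsetSum fun j _ => summable_sq_of_summable_abs (hw j n).1,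
    Finset.prod_const, Finset.card_univ, Fintype.card_fin, Real.sqrt_eq_rpow,
    ← Real.rpow_mul_natCast (hnonneg n), one_div_mul_eq_div]
  rfl

theorem IsBoundedStationary.tendsto_cumulant_inner_normalizedSums
    (hX : IsBoundedStationary μ X c) (hw : ∀ j, IsSummationSequence (w j))
    (hcomp : ∀ j j', (fun n => sqSum (w j n)) =O[atTop] fun n => sqSum (w j' n))
    (hcum : NegligibleCumulants μ X w) (a : EuclideanSpace ℝ (Fin s)) {r : ℕ} (hr : 3 ≤ r) :
    Tendsto (fun n => cumulant μ fun (_ : Fin r) x => ⟪a, normalizedSums X w n x⟫) atTop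
      (𝓝 0) := by
  simp_rw [hX.cumulant_inner_normalizedSums hw, Finset.prod_div_distrib, div_mul_eq_mul_div,
    mul_div_assoc]
  rw [← Finset.sum_const_zero (s := (Finset.univ : Finset (Fin r → Fin s)))]
  refine tendsto_finsetSum _ fun i _ => ?_
  simpa only [mul_zero] using ((hcum r hr i).trans_isBigO
    (isBigO_rpow_sum_sqSum hw hcomp i)).tendsto_div_nhds_zero.const_mul (∏ k, a (i k))

end NormalizedSums

section Action

variable {E : Type*} [MeasurableSpace E] {μ : Measure E} {d : ℕ} {T : Fin d → E ≃ᵐ E}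

theorem prod_ofFn_zpow_add {G : Type*} [Group G] {n : ℕ} (a : Fin n → G)
    (ha : ∀ i j, Commute (a i) (a j)) (k l : Fin n → ℤ) :
    (List.ofFn fun i => a i ^ (k i + l i)).prod =
      (List.ofFn fun i => a i ^ k i).prod * (List.ofFn fun i => a i ^ l i).prod := by
  induction n with
  | zero => simp only [List.ofFn_zero, List.prod_nil, mul_one]
  | succ n ih =>
    have hcomm : Commute (List.ofFn fun i : Fin n => a i.succ ^ k i.succ).prod (a 0 ^ l 0) := by
      refine Commute.list_prod_left _ _ fun y hy => ?_
      obtain ⟨i, rfl⟩ := List.mem_ofFn.1 hy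
      exact (ha _ _).zpow_zpow _ _
    simp only [List.ofFn_succ, List.prod_cons]
    rw [zpow_add, ih (fun i => a i.succ) (fun i j => ha _ _) (fun i => k i.succ) fun i => l i.succ]
    exact hcomm.symm.mul_mul_mul_comm _ _

theorem act_add (hT : IsCommutingAction μ T) (k l : Lattice d) :
    act T (k + l) = act T k * act T l :=
  prod_ofFn_zpow_add _ (fun i j => Equiv.ext (hT.commute i j)) k l

theorem measurePreserving_zpow {e : E ≃ᵐ E} (he : MeasurePreserving e μ μ) (n : ℤ) :
    MeasurePreserving ((e.toEquiv : Equiv.Perm E) ^ n : Equiv.Perm E) μ μ := by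
  obtain ⟨n, rfl | rfl⟩ := n.eq_nat_or_neg
  · rw [zpow_natCast, Equiv.Perm.coe_pow]
    exact he.iterate n
  · rw [zpow_neg, zpow_natCast, ← inv_pow, Equiv.Perm.coe_pow]
    exact (MeasurePreserving.symm e he).iterate n

theorem measurePreserving_list_prod {L : List (Equiv.Perm E)}
    (hL : ∀ g ∈ L, MeasurePreserving g μ μ) : MeasurePreserving L.prod μ μ := by
  induction L with
  | nil => exact .id μ
  | cons g L ih =>
    rw [List.forall_mem_cons] at hL
    exact hL.1.comp (ih hL.2)

theorem measurePreserving_act (hT : IsCommutingAction μ T) (l : Lattice d) :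
    MeasurePreserving (act T l) μ μ := by
  refine measurePreserving_list_prod fun g hg => ?_
  obtain ⟨i, rfl⟩ := List.mem_ofFn.1 hg
  exact measurePreserving_zpow (hT.measurePreserving i) _

theorem integral_comp_of_measurePreserving {τ : E → E} (hτ : MeasurePreserving τ μ μ) {g : E → ℝ}
    (hg : AEStronglyMeasurable g μ) : ∫ x, g (τ x) ∂μ = ∫ x, g x ∂μ := by
  conv_rhs => rw [← hτ.map_eq]
  exact (integral_map hτ.aemeasurable (by rwa [hτ.map_eq])).symm

theorem ae_norm_le_of_memLp_top {F : Type*} [NormedAddCommGroup F] {f : E → F}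
    (hf : MemLp f ⊤ μ) : ∀ᵐ x ∂μ, ‖f x‖ ≤ (eLpNorm f ⊤ μ).toReal := by
  rw [eLpNorm_exponent_top]
  filter_upwards [ae_le_eLpNormEssSup (f := f) (μ := μ)] with x hx
  rw [← toReal_enorm]
  exact ENNReal.toReal_mono (eLpNorm_exponent_top (f := f) (μ := μ) ▸ hf.eLpNorm_ne_top) hx

theorem IsCommutingAction.isBoundedStationary_field (hT : IsCommutingAction μ T) {f : E → ℝ}
    (hf : MemLp f ⊤ μ) (hf0 : ∫ x, f x ∂μ = 0) :
    IsBoundedStationary μ (field T f) (correlation μ T f) := by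
  have hmeas (l : Lattice d) : AEStronglyMeasurable (field T f l) μ :=
    hf.aestronglyMeasurable.comp_measurePreserving (measurePreserving_act hT l)
  refine ⟨hmeas, ⟨_, fun l => (measurePreserving_act hT l).quasiMeasurePreserving.ae
    (ae_norm_le_of_memLp_top hf)⟩, fun l => ?_, fun k l => ?_⟩
  · exact (integral_comp_of_measurePreserving (measurePreserving_act hT l)
      hf.aestronglyMeasurable).trans hf0
  · have hshift (x : E) : field T f k x = field T f (k - l) (act T l x) := by
      rw [field, field, ← Equiv.Perm.mul_apply, ← act_add hT, sub_add_cancel]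
    simp only [hshift]
    exact integral_comp_of_measurePreserving (measurePreserving_act hT l)
      ((hmeas (k - l)).mul hf.aestronglyMeasurable)

end Action

end WeightedCLT

open WeightedCLT in
theorem proposition3p3_general {Ω : Type*} [MeasurableSpace Ω] {μ : Measure Ω}
    [IsProbabilityMeasure μ] {d s : ℕ} {X : Lattice d → Ω → ℝ} {c : Lattice d → ℝ}
    (hX : IsBoundedStationary μ X c) (hc : Summable fun k => |c k|)
    {ξ : Fin s → Measure (Torus d)} {w : Fin s → ℕ → Lattice d → ℝ}
    (hw : ∀ j, IsSummationSequence (w j)) (hreg : ∀ j, IsRegular (ξ j) (w j))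
    (hcomp : ∀ j j', (fun n => sqSum (w j n)) =O[atTop] fun n => sqSum (w j' n))
    (hortho : AsymptoticallyOrthogonal w) (hcum : NegligibleCumulants μ X w) :
    ∃ φ : C(Torus d, ℝ),
      (∀ k, (c k : ℂ) = ∫ t, UnitAddTorus.mFourier k t * (φ t : ℂ) ∂torusMeasure d) ∧
      (∀ j, 0 ≤ ∫ t, φ t ∂ξ j) ∧
      TendstoInDistribution (normalizedSums X w) atTop id (fun _ => μ)
        (multivariateGaussian 0 (Matrix.diagonal fun j => ∫ t, φ t ∂ξ j)) := by
  obtain ⟨φ, hφ, hφc⟩ := exists_spectralDensity hc hX.covariance_neg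
  have hcov (j j' : Fin s) := hX.tendsto_integral_normalizedSums_mul hc hφ hφc hw hreg hcomp
    hortho j j'
  have hnonneg (j : Fin s) : 0 ≤ ∫ t, φ t ∂ξ j := by
    simpa only [if_true] using
      ge_of_tendsto' (hcov j j) fun n => integral_nonneg fun x => mul_self_nonneg _
  refine ⟨φ, hφc, hnonneg, tendstoInDistribution_multivariateGaussian
    (Matrix.PosSemidef.diagonal hnonneg) (fun n r => hX.memLp_normalizedSums hw n r)
    (hX.integral_inner_normalizedSums hw) (fun a => ?_)
    fun a r => hX.tendsto_cumulant_inner_normalizedSums hw hcomp hcum a⟩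
  simp only [integral_inner_sq (hX.memLp_normalizedSums hw _ 2)]
  have hlim := tendsto_finsetSum Finset.univ fun j _ => tendsto_finsetSum Finset.univ fun j' _ =>
    (hcov j j').const_mul (a j * a j')
  simpa only [dotProduct, Matrix.mulVec_diagonal, mul_ite, mul_zero, Finset.sum_ite_eq,
    Finset.mem_univ, if_true, mul_assoc, mul_comm (a _) (∫ _, _ ∂_)] using hlim

theorem proposition3p3 {E : Type*} [MeasurableSpace E] (μ : Measure E) [IsProbabilityMeasure μ]
    {d s : ℕ} (T : Fin d → E ≃ᵐ E) (hT : WeightedCLT.IsCommutingAction μ T)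
    (f : E → ℝ) (hf : MemLp f ⊤ μ) (hf0 : ∫ x, f x ∂μ = 0)
    (hcorr : Summable fun k => |WeightedCLT.correlation μ T f k|)
    (ξ : Fin s → Measure (WeightedCLT.Torus d)) [∀ j, IsProbabilityMeasure (ξ j)]
    (w : Fin s → ℕ → WeightedCLT.Lattice d → ℝ)
    (hw : ∀ j, WeightedCLT.IsSummationSequence (w j))
    (hreg : ∀ j, WeightedCLT.IsRegular (ξ j) (w j))
    (hcomp : ∀ j j', (fun n => WeightedCLT.sqSum (w j n)) =O[atTop]
      fun n => WeightedCLT.sqSum (w j' n))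
    (hortho : WeightedCLT.AsymptoticallyOrthogonal w)
    (hcum : WeightedCLT.NegligibleCumulants μ (WeightedCLT.field T f) w) :
    ∃ φ : C(WeightedCLT.Torus d, ℝ), WeightedCLT.IsSpectralDensity μ T f φ ∧
      (∀ j, 0 ≤ ∫ t, φ t ∂(ξ j)) ∧
      TendstoInDistribution (WeightedCLT.normalizedSums (WeightedCLT.field T f) w) atTop id
        (fun _ => μ)
        (multivariateGaussian 0 (Matrix.diagonal fun j => ∫ t, φ t ∂(ξ j))) :=
  proposition3p3_general (hT.isBoundedStationary_field hf hf0) hcorr hw hreg hcomp hortho hcum
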